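/- Let $M$ be a connected compact Riemannian manifold of finite dimension $d\ge 2$ (a boundary is allowed), with induced distance $\operatorname{dist}$, and let $f:M\to M$ be a $C^1$ map with $\inf_{x\in M}\|Df(x)\|>0$. For $x\in M$ put $$\chi^-(x)=\liminf_{n\to+\infty}\,\ln\|Df^n(x)\|^{1/n}\in[-\infty,+\infty),$$ where $\ln 0=-\infty$ and $\|\cdot\|$ is the operator norm given by the Riemannian metric. A set $\{p,f(p),\dots,f^{\tau-1}(p)\}$ with $\tau\ge 1$ and $f^\tau(p)=p$ (here $\tau$ need not be the least period) is called a sink if there are a neighborhood $V$ of $p$ and a constant $0<\lambda<1$ with $f^\tau(V)\subset V$ and $\operatorname{dist}(f^\tau(q),f^\tau(r))\le\lambda\operatorname{dist}(q,r)$ for all $q,r\in V$. Let $K\subset M$ be a compact set which is $f$-invariant, i.e. $f(K)=K$, and suppose that $\chi^-(x)<0$ for all $x\in K$. Then $K$ is the union of a finite (possibly empty, if $K=\emptyset$) family of sinks of $f$. -/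

import Mathlib

open Set Filter Topology
open scoped Manifold ContDiff Bundle

/-- The lower asymptotic growth rate
`χ⁻(x) = liminf_{n → ∞} ln (‖Df^n(x)‖^{1/n})` of the derivative of `f` along the forward orbit of
`x`, with values in `[-∞, ∞]` and with the convention `ln 0 = -∞`. The norm is the operator norm
with respect to the Riemannian norms on the tangent spaces at `x` and at `f^n(x)`. -/
noncomputable def lowerExponent {E : Type*} [NormedAddCommGroup E] [NormedSpace ℝ E]
    {H : Type*} [TopologicalSpace H] (I : ModelWithCorners ℝ E H)
    {M : Type*} [TopologicalSpace M] [ChartedSpace H M]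
    [Bundle.RiemannianBundle (fun x : M => TangentSpace I x)]
    (f : M → M) (x : M) : EReal :=
  liminf (fun n : ℕ => ENNReal.log (‖mfderiv I I (f^[n]) x‖ₑ ^ (1 / (n : ℝ)))) atTop

/-- The map `g` restricts to a contraction of some neighborhood `V` of `p` into itself. -/
def IsContractionNear {M : Type*} [MetricSpace M] (g : M → M) (p : M) : Prop :=
  ∃ V ∈ 𝓝 p, MapsTo g V V ∧
    ∃ c : ℝ, 0 < c ∧ c < 1 ∧ ∀ q ∈ V, ∀ r ∈ V, dist (g q) (g r) ≤ c * dist q r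

/-- The set `S` is a sink (an attracting periodic orbit) of `f`: it is the orbit
`{p, f p, …, f^(τ-1) p}` of a point `p` with `f^τ p = p`, where the period `τ ≥ 1` (not required to
be the least one) is such that `f^τ` is a contraction of a neighborhood of `p` into itself. -/
def IsSink {M : Type*} [MetricSpace M] (f : M → M) (S : Set M) : Prop :=
  ∃ (p : M) (τ : ℕ), 0 < τ ∧ f^[τ] p = p ∧ S = (fun i : ℕ => f^[i] p) '' Iio τ ∧
    IsContractionNear (f^[τ]) p

/-! A negative lower exponent at `x` gives some `n > 0` with `‖Df^n(x)‖ < 1`. This is an open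
condition, so compactness of `K` yields a uniform factor and a bound `T` on the times `n`. Chaining
such blocks along orbits in `K` makes one iterate `f^N` contract tangent vectors at every point of
`K` (`IsCompact.exists_iterate_derivBound`). The bound persists near `K`, and integrating it along
almost shortest paths makes `f^N` contract balls of a fixed radius centred on `K`
(`IsCompact.exists_dist_le_of_derivBound`).

Since `f^N` maps `K` onto itself, a fixed number of balls of arbitrarily small radius covers `K`, so
`K` is finite. Then `f` permutes `K`, and each of its points lies on a periodic orbit near which a
power of `f^N` contracts. -/

/-! ### Contraction near a compact invariant set -/

section Metric

variable {X : Type*} [MetricSpace X]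

/-- Iterating a map that contracts balls of radius `δ` around the points of an invariant set. -/
theorem iterate_contracts_ball {g : X → X} {K : Set X} (hg : MapsTo g K K) {δ c : ℝ} (hδ : 0 < δ)
    (hc0 : 0 ≤ c) (hc1 : c ≤ 1)
    (h : ∀ x ∈ K, ∀ q ∈ Metric.ball x δ, ∀ r ∈ Metric.ball x δ, dist (g q) (g r) ≤ c * dist q r)
    (k : ℕ) {x : X} (hx : x ∈ K) :
    MapsTo g^[k] (Metric.ball x δ) (Metric.ball (g^[k] x) δ) ∧
      ∀ q ∈ Metric.ball x δ, ∀ r ∈ Metric.ball x δ,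
        dist (g^[k] q) (g^[k] r) ≤ c ^ k * dist q r := by
  induction k generalizing x with
  | zero => exact ⟨fun q hq => hq, fun q _ r _ => by simp⟩
  | succ k ih =>
    have hmaps : MapsTo g (Metric.ball x δ) (Metric.ball (g x) δ) := fun q hq => by
      have := h x hx q hq x (Metric.mem_ball_self hδ)
      have hq' : dist q x < δ := hq
      have : dist (g q) (g x) < δ := by nlinarith [dist_nonneg (x := q) (y := x)]
      exact this
    obtain ⟨ih1, ih2⟩ := ih (hg hx)
    refine ⟨fun q hq => ih1 (hmaps hq), fun q hq r hr => ?_⟩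
    calc dist (g^[k] (g q)) (g^[k] (g r)) ≤ c ^ k * dist (g q) (g r) :=
          ih2 _ (hmaps hq) _ (hmaps hr)
      _ ≤ c ^ k * (c * dist q r) := by gcongr; exact h x hx q hq r hr
      _ = c ^ (k + 1) * dist q r := by ring

/-- A compact set which is mapped onto itself by a locally uniformly contracting map is finite. -/
theorem IsCompact.finite_of_contracts_ball {g : X → X} {K : Set X} (hK : IsCompact K)
    (hg : g '' K = K) {δ c : ℝ} (hδ : 0 < δ) (hc0 : 0 ≤ c) (hc1 : c < 1)
    (h : ∀ x ∈ K, ∀ q ∈ Metric.ball x δ, ∀ r ∈ Metric.ball x δ, dist (g q) (g r) ≤ c * dist q r) :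
    K.Finite := by
  have hmaps : MapsTo g K K := mapsTo_iff_image_subset.2 hg.subset
  have himg (k : ℕ) : g^[k] '' K = K := by
    induction k with
    | zero => simp
    | succ k ih => rw [Function.iterate_succ, image_comp, hg, ih]
  obtain ⟨t, htK, htfin, hcov⟩ := hK.finite_cover_balls hδ
  have happrox (k : ℕ) (y : X) (hy : y ∈ K) : ∃ x ∈ t, dist y (g^[k] x) ≤ c ^ k * δ := by
    rw [← himg k] at hy
    obtain ⟨z, hz, rfl⟩ := hy
    obtain ⟨x, hx, hzx⟩ := mem_iUnion₂.1 (hcov hz)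
    refine ⟨x, hx, ((iterate_contracts_ball hmaps hδ hc0 hc1.le h k (htK hx)).2 z hzx x
      (Metric.mem_ball_self hδ)).trans ?_⟩
    gcongr
    exact (Metric.mem_ball.1 hzx).le
  by_contra hinf
  obtain ⟨s, hsK, hscard⟩ := Set.Infinite.exists_subset_card_eq hinf (htfin.toFinset.card + 1)
  obtain ⟨ε, hε, hsep⟩ : ∃ ε > 0, ∀ x ∈ s, ∀ y ∈ s, x ≠ y → ε ≤ dist x y := by
    by_cases hs : (s : Set X).Nontrivial
    · exact ⟨_, s.finite_toSet.infsep_pos_iff_nontrivial.2 hs, fun x hx y hy hxy =>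
        Set.infsep_le_dist_of_mem hx hy hxy⟩
    · exact ⟨1, one_pos, fun x hx y hy hxy => absurd ⟨x, hx, y, hy, hxy⟩ hs⟩
  -- Among the `card t + 1` points of `s`, two share the same approximant, so they are at distance
  -- at most `2 * c ^ k * δ < ε`.
  obtain ⟨k, hk⟩ := exists_pow_lt_of_lt_one (div_pos hε (by positivity : 0 < 2 * δ)) hc1
  rw [lt_div_iff₀ (by positivity)] at hk
  choose! F hFt hF using happrox k
  obtain ⟨x, hx, y, hy, hxy, hFxy⟩ := Finset.exists_ne_map_eq_of_card_lt_of_maps_to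
    (s := s) (t := htfin.toFinset) (by omega) (f := F)
    (fun x hx => by simpa using hFt x (hsK hx))
  have h1 := hF x (hsK hx)
  have h2 := hF y (hsK hy)
  rw [← hFxy] at h2
  linarith [hsep x hx y hy hxy, dist_triangle_right x y (g^[k] (F x))]

/-- A map that sends a finite set onto itself has only periodic points there. -/
theorem Set.Finite.exists_iterate_eq_self {α : Type*} {f : α → α} {K : Set α} (hK : K.Finite)
    (hf : f '' K = K) {p : α} (hp : p ∈ K) : ∃ m > 0, f^[m] p = p := by
  have hmaps : MapsTo f K K := mapsTo_iff_image_subset.2 hf.subset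
  have := hK.to_subtype
  have hsurj : Function.Surjective (hmaps.restrict f K K) := by
    rintro ⟨y, hy⟩
    rw [← hf] at hy
    obtain ⟨x, hx, rfl⟩ := hy
    exact ⟨⟨x, hx⟩, rfl⟩
  obtain ⟨m, hm, hper⟩ := (Finite.injective_iff_surjective.2 hsurj).mem_periodicPts ⟨p, hp⟩
  refine ⟨m, hm, ?_⟩
  have := congrArg Subtype.val hper.eq
  rwa [hmaps.iterate_restrict, MapsTo.val_restrict_apply] at this

/-- A compact invariant set near which some iterate of the map contracts is a finite union of
sinks. -/
theorem IsCompact.exists_finite_sinks_of_contracts_ball {f : X → X} {K : Set X} (hK : IsCompact K)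
    (hf : f '' K = K) {N : ℕ} (hN : 0 < N) {δ c : ℝ} (hδ : 0 < δ) (hc0 : 0 < c) (hc1 : c < 1)
    (h : ∀ x ∈ K, ∀ q ∈ Metric.ball x δ, ∀ r ∈ Metric.ball x δ,
      dist (f^[N] q) (f^[N] r) ≤ c * dist q r) :
    ∃ 𝒮 : Set (Set X), 𝒮.Finite ∧ (∀ S ∈ 𝒮, IsSink f S) ∧ K = ⋃₀ 𝒮 := by
  have himg (k : ℕ) : f^[k] '' K = K := by
    induction k with
    | zero => simp
    | succ k ih => rw [Function.iterate_succ, image_comp, hf, ih]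
  have hmaps (k : ℕ) : MapsTo f^[k] K K := mapsTo_iff_image_subset.2 (himg k).subset
  have hfin : K.Finite := hK.finite_of_contracts_ball (himg N) hδ hc0.le hc1 h
  choose! m hm0 hm using fun p (hp : p ∈ K) => hfin.exists_iterate_eq_self (himg N) hp
  -- `m p` is a period of `p` under `f^[N]`, so `N * m p` is one under `f`, with contraction factor
  -- `c ^ m p`.
  refine ⟨(fun p => (fun i : ℕ => f^[i] p) '' Iio (N * m p)) '' K, hfin.image _, ?_, ?_⟩
  · rintro _ ⟨p, hp, rfl⟩
    obtain ⟨h1, h2⟩ := iterate_contracts_ball (hmaps N) hδ hc0.le hc1.le h (m p) hp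
    rw [hm p hp] at h1
    refine ⟨p, N * m p, Nat.mul_pos hN (hm0 p hp), ?_, rfl, Metric.ball p δ,
      Metric.ball_mem_nhds p hδ, ?_, c ^ m p, pow_pos hc0 _,
      pow_lt_one₀ hc0.le hc1 (hm0 p hp).ne', ?_⟩ <;> rw [Function.iterate_mul]
    exacts [hm p hp, h1, h2]
  · refine Subset.antisymm (fun p hp => ?_) ?_
    · exact mem_sUnion.2 ⟨_, mem_image_of_mem _ hp, 0, Nat.mul_pos hN (hm0 p hp), rfl⟩
    · rintro _ ⟨_, ⟨p, hp, rfl⟩, i, -, rfl⟩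
      exact hmaps i hp

end Metric

/-! ### Pointwise bounds on the derivative -/

section DerivBound

variable {E : Type*} [NormedAddCommGroup E] [NormedSpace ℝ E]
  {H : Type*} [TopologicalSpace H] {I : ModelWithCorners ℝ E H}
  {M : Type*} [TopologicalSpace M] [ChartedSpace H M]
  [Bundle.RiemannianBundle (fun x : M => TangentSpace I x)]

variable (I) in
/-- The derivative of `g` at `x` multiplies the Riemannian norm of vectors by at most `c`. -/
def DerivBound (g : M → M) (c : ℝ) (x : M) : Prop :=
  ∀ v : TangentSpace I x, ‖mfderiv I I g x v‖ ≤ c * ‖v‖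

theorem DerivBound.mono {g : M → M} {c d : ℝ} {x : M} (h : DerivBound I g c x) (hcd : c ≤ d) :
    DerivBound I g d x := fun v => (h v).trans (by gcongr)

theorem derivBound_id (x : M) : DerivBound I (id : M → M) 1 x := fun v => by
  rw [mfderiv_id, one_mul]; exact le_rfl

theorem derivBound_norm (g : M → M) (x : M) : DerivBound I g ‖mfderiv I I g x‖ x :=
  fun v => (mfderiv I I g x).le_opNorm v

theorem DerivBound.comp {g h : M → M} {c d : ℝ} {x : M} (hc : 0 ≤ c)
    (hg : MDifferentiableAt I I g (h x)) (hh : MDifferentiableAt I I h x)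
    (h1 : DerivBound I g c (h x)) (h2 : DerivBound I h d x) : DerivBound I (g ∘ h) (c * d) x := by
  intro v
  rw [mfderiv_comp x hg hh]
  refine (h1 (mfderiv I I h x v)).trans ?_
  rw [mul_assoc]
  exact mul_le_mul_of_nonneg_left (h2 v) hc

/-- The strict inequality is open in the tangent bundle. Compactness of the unit sphere of `E` in a
trivialization makes it hold for all directions over one neighborhood, and homogeneity extends it to
all vectors. -/
theorem DerivBound.eventually [FiniteDimensional ℝ E] [IsManifold I 1 M]
    [IsContinuousRiemannianBundle E (fun x : M => TangentSpace I x)] {g : M → M}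
    (hg : ContMDiff I I 1 g) {c d : ℝ} {x : M} (h : DerivBound I g c x) (hcd : c < d) :
    ∀ᶠ y in 𝓝 x, DerivBound I g d y := by
  have hnorm : Continuous fun p : TangentBundle I M => ‖p.2‖ := by
    have h1 : Continuous fun p : TangentBundle I M => inner ℝ p.2 p.2 :=
      Continuous.inner_bundle (F := E) (E := fun x : M => TangentSpace I x)
        (b := fun p : TangentBundle I M => p.1) (v := fun p => p.2) (w := fun p => p.2)
        continuous_id continuous_id
    simp_rw [norm_eq_sqrt_real_inner]
    exact h1.sqrt
  have hopen : IsOpen {p : TangentBundle I M | ‖mfderiv I I g p.1 p.2‖ < d * ‖p.2‖} :=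
    isOpen_lt (hnorm.comp (hg.continuous_tangentMap le_rfl)) (continuous_const.mul hnorm)
  let e := trivializationAt E (fun x : M => TangentSpace I x) x
  have hxe : x ∈ e.baseSet := FiberBundle.mem_baseSet_trivializationAt' x
  have hsphere : ∀ᶠ y in 𝓝 x, ∀ v ∈ Metric.sphere (0 : E) 1,
      ‖mfderiv I I g y (e.symm y v)‖ < d * ‖e.symm y v‖ := by
    refine (isCompact_sphere (0 : E) 1).eventually_forall_of_forall_eventually fun v hv => ?_
    have hcont : ContinuousAt e.toOpenPartialHomeomorph.symm (x, v) :=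
      e.toOpenPartialHomeomorph.continuousAt_symm (e.mem_target.2 hxe)
    have hmem : ∀ᶠ q : M × E in 𝓝 (x, v), q.1 ∈ e.baseSet :=
      continuousAt_fst (e.open_baseSet.mem_nhds hxe)
    have hv0 : v ≠ 0 := by
      rintro rfl
      simp at hv
    have hev0 : e.symm x v ≠ 0 := fun h0 =>
      hv0 ((e.continuousLinearEquivAt ℝ x hxe).symm.map_eq_zero_iff.1 h0)
    have hin : e.toOpenPartialHomeomorph.symm (x, v) ∈
        {p : TangentBundle I M | ‖mfderiv I I g p.1 p.2‖ < d * ‖p.2‖} := by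
      rw [← e.mk_symm hxe v]
      exact (h _).trans_lt (mul_lt_mul_of_pos_right hcd (norm_pos_iff.2 hev0))
    filter_upwards [hcont (hopen.mem_nhds hin), hmem] with q hq hqe
    have hq' : e.toOpenPartialHomeomorph.symm (q.1, q.2) ∈
        {p : TangentBundle I M | ‖mfderiv I I g p.1 p.2‖ < d * ‖p.2‖} := hq
    rw [← e.mk_symm hqe q.2] at hq'
    exact hq'
  filter_upwards [hsphere, e.open_baseSet.mem_nhds hxe] with y hy hye w
  let u : E := e.continuousLinearEquivAt ℝ y hye w
  have hu : e.symm y u = w := (e.continuousLinearEquivAt ℝ y hye).symm_apply_apply w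
  rcases eq_or_ne w 0 with rfl | hw
  · simp
  have hu0 : u ≠ 0 := fun h0 => hw ((e.continuousLinearEquivAt ℝ y hye).map_eq_zero_iff.1 h0)
  have hsm : e.symm y (‖u‖⁻¹ • u) = ‖u‖⁻¹ • w := by
    rw [← hu]
    exact (e.continuousLinearEquivAt ℝ y hye).symm.map_smul _ _
  have := hy (‖u‖⁻¹ • u) (by simp [norm_smul, hu0])
  rw [hsm, map_smul, norm_smul, norm_smul, mul_left_comm] at this
  exact (lt_of_mul_lt_mul_left this (by positivity)).le

end DerivBound

/-! ### From derivatives to distances -/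

section Path
variable {E : Type*} [NormedAddCommGroup E] [NormedSpace ℝ E]
  {H : Type*} [TopologicalSpace H] {I : ModelWithCorners ℝ E H}
  {M : Type*} [MetricSpace M] [ChartedSpace H M]
  [Bundle.RiemannianBundle (fun x : M => TangentSpace I x)]
  [IsRiemannianManifold I M]

/-- A bound on the derivative of `g` over a ball gives a Lipschitz estimate from its center. -/
theorem edist_le_of_derivBound {g : M → M} (hg : ContMDiff I I 1 g) {c : ℝ} (hc : 0 < c)
    {R : ENNReal} {q r : M} (hR : ∀ z, edist q z < R → DerivBound I g c z) (hqr : edist q r < R) :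
    edist (g q) (g r) ≤ ENNReal.ofReal c * edist q r := by
  -- Otherwise some path from `q` to `r` is shorter than both `R` and `edist (g q) (g r) / c`. It
  -- stays in the ball, so its image is too short to join `g q` to `g r`.
  by_contra! hlt
  have hc0 : ENNReal.ofReal c ≠ 0 := (ENNReal.ofReal_pos.2 hc).ne'
  rw [mul_comm, ← ENNReal.lt_div_iff_mul_lt (.inl hc0) (.inl ENNReal.ofReal_ne_top)] at hlt
  have hmin := lt_min hlt hqr
  rw [IsRiemannianManifold.out (I := I) q r] at hmin
  obtain ⟨γ, h0, h1, hγ, hlen, -⟩ :=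
    Manifold.exists_lt_locally_constant_of_riemannianEDist_lt hmin zero_lt_one
  have hball (t : ℝ) (ht : t ∈ Icc (0 : ℝ) 1) : edist q (γ t) < R := by
    rw [IsRiemannianManifold.out (I := I) q (γ t)]
    calc _ ≤ Manifold.pathELength I γ 0 t :=
          Manifold.riemannianEDist_le_pathELength hγ.contMDiffOn h0 rfl ht.1
      _ ≤ Manifold.pathELength I γ 0 1 := Manifold.pathELength_mono le_rfl ht.2
      _ < R := hlen.trans_le (min_le_right _ _)
  have hcomp : Manifold.pathELength I (g ∘ γ) 0 1 ≤
      ENNReal.ofReal c * Manifold.pathELength I γ 0 1 := by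
    rw [Manifold.pathELength, Manifold.pathELength,
      ← MeasureTheory.lintegral_const_mul' _ _ ENNReal.ofReal_ne_top]
    refine MeasureTheory.setLIntegral_mono' measurableSet_Icc fun t ht => ?_
    rw [mfderiv_comp t ((hg.mdifferentiable one_ne_zero) (γ t))
      ((hγ.mdifferentiable one_ne_zero) t)]
    have := hR _ (hball t ht) (mfderiv 𝓘(ℝ, ℝ) I γ t 1)
    rw [← ofReal_norm, ← ofReal_norm, ← ENNReal.ofReal_mul hc.le]
    exact ENNReal.ofReal_le_ofReal this
  have hle : edist (g q) (g r) ≤ Manifold.pathELength I (g ∘ γ) 0 1 := by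
    rw [IsRiemannianManifold.out (I := I) (g q) (g r)]
    exact Manifold.riemannianEDist_le_pathELength (hg.comp hγ).contMDiffOn
      (by simp [h0]) (by simp [h1]) zero_le_one
  have := hlen.trans_le (min_le_left _ _)
  rw [ENNReal.lt_div_iff_mul_lt (.inl hc0) (.inl ENNReal.ofReal_ne_top), mul_comm] at this
  exact absurd (hle.trans hcomp) this.not_ge

/-- A map whose derivative is bounded by `c` along a compact set `K` contracts all balls of some
fixed radius around points of `K` with any larger factor `d`. -/
theorem IsCompact.exists_dist_le_of_derivBound [FiniteDimensional ℝ E] [IsManifold I 1 M]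
    [IsContinuousRiemannianBundle E (fun x : M => TangentSpace I x)]
    {g : M → M} (hg : ContMDiff I I 1 g) {K : Set M} (hK : IsCompact K) {c d : ℝ} (hd : 0 < d)
    (hcd : c < d) (h : ∀ x ∈ K, DerivBound I g c x) :
    ∃ δ > 0, ∀ x ∈ K, ∀ q ∈ Metric.ball x δ, ∀ r ∈ Metric.ball x δ,
      dist (g q) (g r) ≤ d * dist q r := by
  have hev : ∀ᶠ y in 𝓝ˢ K, DerivBound I g d y :=
    eventually_nhdsSet_iff_forall.2 fun x hx => (h x hx).eventually hg hcd
  obtain ⟨ε, hε, hsub⟩ := (Metric.hasBasis_nhdsSet_thickening hK).mem_iff.1 hev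
  -- Here `dist q r < 2 * ε / 3`, and points within `2 * ε / 3` of `q` are within `ε` of `x`.
  refine ⟨ε / 3, by positivity, fun x hx q hq r hr => ?_⟩
  rw [Metric.mem_ball] at hq hr
  have hle := edist_le_of_derivBound hg hd (R := ENNReal.ofReal (2 * ε / 3)) (q := q) (r := r)
    (fun z hz => hsub (Metric.mem_thickening_iff.2 ⟨x, hx, ?_⟩)) ?_
  · rw [edist_dist, edist_dist, ← ENNReal.ofReal_mul hd.le] at hle
    exact (ENNReal.ofReal_le_ofReal_iff (by positivity)).1 hle
  · rw [edist_dist, ENNReal.ofReal_lt_ofReal_iff (by positivity)] at hz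
    linarith [dist_triangle_left z x q]
  · rw [edist_dist, ENNReal.ofReal_lt_ofReal_iff (by positivity)]
    linarith [dist_triangle_right q r x]
end Path

/-! ### Uniform contraction of tangent vectors -/

section Uniform

variable {E : Type*} [NormedAddCommGroup E] [NormedSpace ℝ E]
  {H : Type*} [TopologicalSpace H] {I : ModelWithCorners ℝ E H}
  {M : Type*} [TopologicalSpace M] [ChartedSpace H M]

theorem ContMDiff.iterate_self {f : M → M} (hf : ContMDiff I I 1 f) (n : ℕ) :
    ContMDiff I I 1 f^[n] := by
  induction n with
  | zero => exact contMDiff_id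
  | succ n ih => exact ih.comp hf

variable [Bundle.RiemannianBundle (fun x : M => TangentSpace I x)]

theorem exists_norm_mfderiv_iterate_lt_one {f : M → M} {x : M} (h : lowerExponent I f x < 0) :
    ∃ n > 0, ‖mfderiv I I (f^[n]) x‖ < 1 := by
  obtain ⟨n, hlt, hn⟩ := ((frequently_lt_of_liminf_lt (by isBoundedDefault) h).and_eventually
    (eventually_gt_atTop 0)).exists
  refine ⟨n, hn, ?_⟩
  rw [ENNReal.log_lt_zero_iff] at hlt
  by_contra! hle
  refine hlt.not_ge (ENNReal.one_le_rpow ?_ (by positivity))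
  rw [← ofReal_norm (E := TangentSpace I x →L[ℝ] TangentSpace I (f^[n] x)), ENNReal.one_le_ofReal]
  exact hle

theorem DerivBound.iterate_add {f : M → M} (hf : ContMDiff I I 1 f) {m n : ℕ} {c d : ℝ} {x : M}
    (hc : 0 ≤ c) (h1 : DerivBound I f^[m] c (f^[n] x)) (h2 : DerivBound I f^[n] d x) :
    DerivBound I f^[m + n] (c * d) x := by
  rw [Function.iterate_add]
  exact h1.comp hc ((hf.iterate_self m).mdifferentiable one_ne_zero _)
    ((hf.iterate_self n).mdifferentiable one_ne_zero _) h2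

variable [FiniteDimensional ℝ E] [IsManifold I 1 M]
  [IsContinuousRiemannianBundle E (fun x : M => TangentSpace I x)]

theorem IsCompact.exists_derivBound {f : M → M} (hf : ContMDiff I I 1 f) {K : Set M}
    (hK : IsCompact K) : ∃ L : ℝ, ∀ x ∈ K, DerivBound I f L x := by
  refine hK.induction_on (p := fun s => ∃ L : ℝ, ∀ x ∈ s, DerivBound I f L x)
    ⟨0, by simp⟩ (fun s t hst ⟨L, hL⟩ => ⟨L, fun x hx => hL x (hst hx)⟩) ?_ ?_
  · rintro s t ⟨L, hL⟩ ⟨L', hL'⟩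
    refine ⟨max L L', fun x hx => ?_⟩
    rcases hx with hx | hx
    exacts [(hL x hx).mono (le_max_left _ _), (hL' x hx).mono (le_max_right _ _)]
  · intro x _
    exact ⟨_, mem_nhdsWithin_of_mem_nhds
      ((derivBound_norm f x).eventually hf (lt_add_one _)), _, fun y hy => hy⟩

/-- If all points of a compact set have negative lower exponent, the derivatives contract by a
uniform factor after a bounded time depending on the point. -/
theorem IsCompact.exists_bounded_time_derivBound {f : M → M} (hf : ContMDiff I I 1 f) {K : Set M}
    (hK : IsCompact K) (h : ∀ x ∈ K, lowerExponent I f x < 0) :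
    ∃ (T : ℕ) (c : ℝ), 0 ≤ c ∧ c < 1 ∧
      ∀ x ∈ K, ∃ n, 0 < n ∧ n ≤ T ∧ DerivBound I f^[n] c x := by
  refine hK.induction_on (p := fun s => ∃ (T : ℕ) (c : ℝ), 0 ≤ c ∧ c < 1 ∧
      ∀ x ∈ s, ∃ n, 0 < n ∧ n ≤ T ∧ DerivBound I f^[n] c x)
    ⟨0, 0, le_rfl, one_pos, by simp⟩
    (fun s t hst ⟨T, c, h0, h1, hs⟩ => ⟨T, c, h0, h1, fun x hx => hs x (hst hx)⟩) ?_ ?_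
  · rintro s t ⟨T, c, h0, h1, hs⟩ ⟨T', c', h0', h1', ht⟩
    refine ⟨max T T', max c c', le_max_of_le_left h0, max_lt h1 h1', fun x hx => ?_⟩
    rcases hx with hx | hx
    · obtain ⟨n, hn, hnT, hb⟩ := hs x hx
      exact ⟨n, hn, le_max_of_le_left hnT, hb.mono (le_max_left _ _)⟩
    · obtain ⟨n, hn, hnT, hb⟩ := ht x hx
      exact ⟨n, hn, le_max_of_le_right hnT, hb.mono (le_max_right _ _)⟩
  · intro x hx
    obtain ⟨n, hn, hlt⟩ := exists_norm_mfderiv_iterate_lt_one (h x hx)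
    -- The gap between the norm and `c` lets the bound spread to a neighborhood.
    obtain ⟨c, hc, hc1⟩ := exists_between hlt
    exact ⟨_, mem_nhdsWithin_of_mem_nhds
      ((derivBound_norm _ x).eventually (hf.iterate_self n) hc), n, c,
      (ContinuousLinearMap.opNorm_nonneg _).trans hc.le, hc1, fun y hy => ⟨n, hn, le_rfl, hy⟩⟩

/-- If all points of a compact invariant set have negative lower exponent, then some iterate
contracts tangent vectors over the whole set by a uniform factor. -/
theorem IsCompact.exists_iterate_derivBound {f : M → M} (hf : ContMDiff I I 1 f) {K : Set M}
    (hK : IsCompact K) (hmaps : MapsTo f K K) (h : ∀ x ∈ K, lowerExponent I f x < 0) :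
    ∃ N > 0, ∃ c : ℝ, 0 ≤ c ∧ c < 1 ∧ ∀ x ∈ K, DerivBound I f^[N] c x := by
  obtain ⟨T, c, hc0, hc1, hT⟩ := hK.exists_bounded_time_derivBound hf h
  obtain ⟨L₀, hL₀⟩ := hK.exists_derivBound hf
  -- With `L ≥ 1`, the constant `L ^ T` covers every time up to `T`.
  set L := max L₀ 1
  have hL1 : 1 ≤ L := le_max_right _ _
  have hL (n : ℕ) : ∀ x ∈ K, DerivBound I f^[n] (L ^ n) x := by
    induction n with
    | zero => exact fun x _ => by simpa using derivBound_id x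
    | succ n ih =>
      intro x hx
      rw [pow_succ]
      exact DerivBound.iterate_add hf (n := 1) (by positivity) (ih _ (hmaps hx))
        ((hL₀ x hx).mono (le_max_left _ _))
  have hmaps' (n : ℕ) : MapsTo f^[n] K K := hmaps.iterate n
  -- Splitting off contracting blocks until at most `T` steps remain gives a bound independent of
  -- `n`.
  have hbdd (n : ℕ) : ∀ x ∈ K, DerivBound I f^[n] (L ^ T) x := by
    induction n using Nat.strong_induction_on with
    | _ n ih =>
      intro x hx
      rcases le_or_gt n T with hn | hn
      · exact (hL n x hx).mono (pow_le_pow_right₀ hL1 hn)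
      · obtain ⟨m, hm, hmT, hb⟩ := hT x hx
        have := (ih (n - m) (by omega) _ (hmaps' m hx)).iterate_add hf (by positivity) hb
        rw [Nat.sub_add_cancel (by omega)] at this
        exact this.mono (mul_le_of_le_one_right (by positivity) hc1.le)
  -- Blocks last at most `T`, so time `k * T` leaves room for `k` of them; `hbdd` handles the rest.
  have hpow (k : ℕ) : ∀ n, k * T ≤ n → ∀ x ∈ K, DerivBound I f^[n] (L ^ T * c ^ k) x := by
    induction k with
    | zero => exact fun n _ x hx => by simpa using hbdd n x hx
    | succ k ih =>
      intro n hn x hx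
      obtain ⟨m, hm, hmT, hb⟩ := hT x hx
      rw [add_mul, one_mul] at hn
      have := (ih (n - m) (by omega) _ (hmaps' m hx)).iterate_add hf (by positivity) hb
      rw [Nat.sub_add_cancel (by omega)] at this
      rwa [pow_succ, ← mul_assoc]
  obtain ⟨k, hk⟩ := exists_pow_lt_of_lt_one (by positivity : 0 < (L ^ T)⁻¹) hc1
  -- The `+ 1` keeps the exponent positive even when `T = 0`, which happens only for empty `K`.
  refine ⟨k * T + 1, Nat.succ_pos _, L ^ T * c ^ k, by positivity, ?_,
    hpow k _ (Nat.le_succ _)⟩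
  calc L ^ T * c ^ k < L ^ T * (L ^ T)⁻¹ := by gcongr
    _ = 1 := mul_inv_cancel₀ (by positivity)

end Uniform

/-- `M` is a connected compact Riemannian manifold (possibly with boundary or corners) of finite
dimension at least two, with its Riemannian distance. -/
theorem mainTheorem7
    {E : Type*} [NormedAddCommGroup E] [NormedSpace ℝ E] [FiniteDimensional ℝ E]
    (hdim : 2 ≤ Module.finrank ℝ E)
    {H : Type*} [TopologicalSpace H] (I : ModelWithCorners ℝ E H)
    {M : Type*} [MetricSpace M] [CompactSpace M] [ConnectedSpace M]
    [ChartedSpace H M] [IsManifold I 1 M]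
    [Bundle.RiemannianBundle (fun x : M => TangentSpace I x)]
    [IsContinuousRiemannianBundle E (fun x : M => TangentSpace I x)]
    [IsRiemannianManifold I M]
    (f : M → M) (hf : ContMDiff I I 1 f)
    (hDf : 0 < ⨅ x : M, ‖mfderiv I I f x‖)
    (K : Set M) (hK : IsCompact K) (hinv : f '' K = K)
    (hneg : ∀ x ∈ K, lowerExponent I f x < 0) :
    ∃ 𝒮 : Set (Set M), 𝒮.Finite ∧ (∀ S ∈ 𝒮, IsSink f S) ∧ K = ⋃₀ 𝒮 := by
  obtain ⟨N, hN, c, hc0, hc1, hb⟩ :=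
    hK.exists_iterate_derivBound hf (mapsTo_iff_image_subset.2 hinv.subset) hneg
  -- The factor worsens from `c` to `d` in passing from points of `K` to balls around them; `d` is
  -- positive even if `c = 0`.
  obtain ⟨d, hcd, hd1⟩ := exists_between hc1
  obtain ⟨δ, hδ, hball⟩ :=
    hK.exists_dist_le_of_derivBound (hf.iterate_self N) (hc0.trans_lt hcd) hcd hb
  exact hK.exists_finite_sinks_of_contracts_ball hinv hN hδ (hc0.trans_lt hcd) hd1 hball
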